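/- Let $m>1/2$ and $\theta\in\mathbb R$. For $\mu\in\mathbb R$ let $\mathrm{PVII}_m(\mu,1)$ be the Pearson Type VII distribution on $\mathbb R$ with location $\mu$ and scale $1$, i.e. the distribution with density $$f(x;\mu)=c_m\bigl(1+(x-\mu)^2\bigr)^{-m},\qquad c_m=\Bigl(\int_{\mathbb R}(1+x^2)^{-m}\,dx\Bigr)^{-1}.$$ Let $X_1,X_2,\dots$ be i.i.d. random variables with distribution $\mathrm{PVII}_m(\theta,1)$ on a probability space $(\Omega,\mathcal F,P)$. For each $n\ge1$ let $\hat\theta_n:\mathbb R^n\to\mathbb R$ be any measurable function such that, for every $(x_1,\dots,x_n)\in\mathbb R^n$, the value $\hat\theta_n(x_1,\dots,x_n)$ is a global maximizer of the likelihood $t\mapsto\prod_{i=1}^n f(x_i;t)$, and write $\hat\theta_n=\hat\theta_n(X_1,\dots,X_n)$ for the resulting maximum likelihood estimator. Then $E[(\hat\theta_n-\theta)^2]<\infty$ for all sufficiently large $n$, and $$\lim_{n\to\infty} n\,E\bigl[(\hat\theta_n-\theta)^2\bigr]=\frac{m+1}{m(2m-1)}=\frac1{I(\theta)},$$ where $I(\theta)=E\Bigl[\bigl(\partial_t\log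 f(X_1;t)\big|_{t=\theta}\bigr)^2\Bigr]$ is the Fisher information of a single observation. -/

import Mathlib

open MeasureTheory ProbabilityTheory Filter Topology

noncomputable section

namespace PearsonVII

/-- The normalizing constant `c_m = (∫ (1 + x²)^(-m) dx)⁻¹`. -/
def normConst (m : ℝ) : ℝ := (∫ x : ℝ, (1 + x ^ 2) ^ (-m))⁻¹

/-- The density of the Pearson Type VII distribution with shape `m`, location `μ`, scale `σ`. -/
def density (m μ σ x : ℝ) : ℝ := normConst m * (1 / σ) * (1 + ((x - μ) / σ) ^ 2) ^ (-m)

/-- The Pearson Type VII distribution with shape `m`, location `μ` and scale `σ`. -/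
def law (m μ σ : ℝ) : Measure ℝ :=
  (volume : Measure ℝ).withDensity (fun x => ENNReal.ofReal (density m μ σ x))

/-- The likelihood of the location `t` (with scale `1`), given the sample `x`. -/
def likelihood (m : ℝ) {n : ℕ} (x : Fin n → ℝ) (t : ℝ) : ℝ := ∏ i, density m t 1 (x i)

/-- `T` is a maximum likelihood estimator of the location for samples of size `n`: a measurable
function whose value at each sample is a global maximizer of the likelihood. -/
structure IsMLE (m : ℝ) (n : ℕ) (T : (Fin n → ℝ) → ℝ) : Prop where
  measurable : Measurable T
  maximizes : ∀ (x : Fin n → ℝ) (t : ℝ), likelihood m x t ≤ likelihood m x (T x)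

/-- The Fisher information at `θ` for the location parameter, for a single observation:
the second moment under `law m θ 1` of the score `∂/∂t log f(x; t)` at `t = θ`. -/
def fisherInformation (m θ : ℝ) : ℝ :=
  ∫ x, (deriv (fun t => Real.log (density m t 1 x)) θ) ^ 2 ∂(law m θ 1)

end PearsonVII

end

noncomputable section

namespace PearsonVII

/-! Put `Y i = X i - θ`. The error `D n` of the estimator minimizes the empirical loss `∑ loss (Y i
- t)`. The first-order condition and a Taylor expansion of the score make the average of `score (Y
i)` equal to `A * D n` up to `4 * ε * |D n|`, with `A` the mean of `scoreDeriv`, as soon as `|D n| ≤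
ε` and the average of `scoreDeriv (Y i)` is within `ε` of `A`. The average score has second moment
exactly `B / n`, with `B` the mean of `score ^ 2`, which suggests the limit `B / A ^ 2`
(`tendsto_mse`).

Convergence of second moments also requires the exceptional event to contribute `o(1/n)`. There `D²
≤ D⁴ / n² + n²`, so a bounded fourth moment of `D n` and probability `o(n⁻³)` suffice
(`eventually_mse_bounds`). The fourth moment is bounded for large `n` although the observations are
heavy-tailed, because `1 + D²` is at most twice the exponential of an average of logarithms
(`exists_integral_pow_four_le`). The probability bound combines Hoeffding's inequality, a Chernoff
bound against escape to infinity, and compactness together with positivity of the Kullback-Leibler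
divergence (`negligible_abs_gt`).

A recursion for `∫ (1 + x²)^(-s)` evaluates `A` and `B`; they satisfy `B = A / m`, and the Fisher
information is `m² B = m A`. -/

/-- The loss `log (1 + u²)`, the negative log-likelihood up to scaling and an additive constant. -/
def loss (u : ℝ) : ℝ := Real.log (1 + u ^ 2)

/-- The derivative of `loss`. -/
def score (u : ℝ) : ℝ := 2 * u / (1 + u ^ 2)

/-- The derivative of `score`. -/
def scoreDeriv (u : ℝ) : ℝ := 2 * (1 - u ^ 2) / (1 + u ^ 2) ^ 2

lemma one_add_sq_pos (u : ℝ) : 0 < 1 + u ^ 2 := by positivity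

lemma loss_nonneg (u : ℝ) : 0 ≤ loss u :=
  Real.log_nonneg (by nlinarith [sq_nonneg u])

lemma exp_mul_loss (q u : ℝ) : Real.exp (q * loss u) = (1 + u ^ 2) ^ q := by
  rw [Real.rpow_def_of_pos (one_add_sq_pos u), loss, mul_comm]

@[fun_prop]
lemma continuous_loss : Continuous loss :=
  (by fun_prop : Continuous fun u : ℝ => 1 + u ^ 2).log fun u => (one_add_sq_pos u).ne'

@[fun_prop]
lemma continuous_score : Continuous score :=
  Continuous.div (by fun_prop) (by fun_prop) fun u => (one_add_sq_pos u).ne'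

@[fun_prop]
lemma continuous_scoreDeriv : Continuous scoreDeriv :=
  Continuous.div (by fun_prop) (by fun_prop) fun u => (pow_pos (one_add_sq_pos u) 2).ne'

lemma hasDerivAt_loss (u : ℝ) : HasDerivAt loss (score u) u := by
  have h : HasDerivAt (fun u : ℝ => 1 + u ^ 2) (2 * u) u := by
    simpa using (hasDerivAt_pow 2 u).const_add 1
  exact h.log (one_add_sq_pos u).ne'

lemma abs_score_le (u : ℝ) : |score u| ≤ 1 := by
  rw [score, abs_div, abs_of_pos (one_add_sq_pos u), div_le_one (one_add_sq_pos u), abs_le]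
  constructor <;> nlinarith [sq_nonneg (u - 1), sq_nonneg (u + 1)]

lemma abs_scoreDeriv_le (u : ℝ) : |scoreDeriv u| ≤ 2 := by
  have h := pow_pos (one_add_sq_pos u) 2
  rw [scoreDeriv, abs_div, abs_of_pos h, div_le_iff₀ h, abs_le]
  constructor <;> nlinarith [sq_nonneg u, sq_nonneg (u ^ 2)]

lemma abs_loss_sub_le (u v : ℝ) : |loss u - loss v| ≤ |u - v| := by
  have := (convex_univ (𝕜 := ℝ) (E := ℝ)).norm_image_sub_le_of_norm_hasDerivWithin_le
    (f := loss) (f' := score) (C := 1)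
    (fun x _ => (hasDerivAt_loss x).hasDerivWithinAt) (fun x _ => abs_score_le x)
    (Set.mem_univ v) (Set.mem_univ u)
  simpa using this

/-- Second-order Taylor estimate for the score. -/
lemma abs_score_sub_taylor_le (y d : ℝ) :
    |score (y - d) - score y + d * scoreDeriv y| ≤ 3 * d ^ 2 := by
  set u := y - d with hu
  have hd : d = y - u := by rw [hu]; ring
  have ha := one_add_sq_pos y
  have hb := one_add_sq_pos u
  -- The Taylor remainder is computed exactly: `d ^ 2` factors out and leaves a bounded rational
  -- function.
  have key : score u - score y + d * scoreDeriv y =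
      2 * d ^ 2 * (y ^ 2 * u - u - 2 * y) / ((1 + y ^ 2) ^ 2 * (1 + u ^ 2)) := by
    rw [score, score, scoreDeriv, hd]
    field_simp
    ring
  have hab : 0 < (1 + y ^ 2) ^ 2 * (1 + u ^ 2) := by positivity
  rw [key, abs_div, abs_of_pos hab, div_le_iff₀ hab, abs_mul, abs_of_nonneg (by positivity)]
  have h1 : |y ^ 2 * u - u - 2 * y| ≤ 3 / 2 * ((1 + y ^ 2) ^ 2 * (1 + u ^ 2)) := by
    have e1 : |u| ≤ (1 + u ^ 2) / 2 := by
      rw [abs_le]; constructor <;> nlinarith [sq_nonneg (u - 1), sq_nonneg (u + 1)]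
    have e2 : |y| ≤ (1 + y ^ 2) / 2 := by
      rw [abs_le]; constructor <;> nlinarith [sq_nonneg (y - 1), sq_nonneg (y + 1)]
    have e3 : |y ^ 2 * u - u - 2 * y| ≤ (1 + y ^ 2) * |u| + 2 * |y| := by
      have : |y ^ 2 - 1| ≤ 1 + y ^ 2 := by
        rw [abs_le]; constructor <;> nlinarith [sq_nonneg y]
      calc |y ^ 2 * u - u - 2 * y| = |(y ^ 2 - 1) * u - 2 * y| := by ring_nf
        _ ≤ |(y ^ 2 - 1) * u| + |2 * y| := abs_sub _ _
        _ = |y ^ 2 - 1| * |u| + 2 * |y| := by rw [abs_mul, abs_mul]; norm_num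
        _ ≤ _ := by gcongr
    have e4 : (1 + y ^ 2) * |u| ≤ (1 + y ^ 2) * ((1 + u ^ 2) / 2) := by gcongr
    have e5 : 1 * ((1 + y ^ 2) * (1 + u ^ 2)) ≤
        (1 + y ^ 2) * ((1 + y ^ 2) * (1 + u ^ 2)) := by gcongr; nlinarith [sq_nonneg y]
    have e6 : (1 + y ^ 2) * 1 ≤ (1 + y ^ 2) * (1 + u ^ 2) := by gcongr; nlinarith [sq_nonneg u]
    nlinarith
  nlinarith [mul_le_mul_of_nonneg_left h1 (by positivity : 0 ≤ 2 * d ^ 2)]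

/-- Since `d = y - (y - d)`, `d² ≤ 2 (y - d)² + 2 y²`. Thus the loss is subadditive up to `log 2`.
-/
lemma loss_le_add (y d : ℝ) : loss d ≤ Real.log 2 + loss (y - d) + loss y := by
  rw [loss, loss, loss, ← Real.log_mul (by norm_num) (one_add_sq_pos _).ne',
    ← Real.log_mul (mul_pos two_pos (one_add_sq_pos _)).ne' (one_add_sq_pos _).ne']
  apply Real.log_le_log (one_add_sq_pos d)
  nlinarith [sq_nonneg (y - d + y), sq_nonneg ((y - d) * y), sq_nonneg (y - d - y),
    sq_nonneg ((y-d) + y)]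

/-! ### Deterministic properties of loss minimizers -/

/-- `d` minimizes the empirical loss of the first `n` entries of `y`. -/
def IsLossMinimizer (y : ℕ → ℝ) (n : ℕ) (d : ℝ) : Prop :=
  ∀ t, ∑ i ∈ Finset.range n, loss (y i - d) ≤ ∑ i ∈ Finset.range n, loss (y i - t)

namespace IsLossMinimizer

variable {y : ℕ → ℝ} {n : ℕ} {d : ℝ}

/-- Summing `loss_le_add` over the sample and comparing `d` with the competitor `0` bounds both loss
sums by the one at `0`. -/
lemma nat_mul_loss_le (h : IsLossMinimizer y n d) :
    n * loss d ≤ n * Real.log 2 + 2 * ∑ i ∈ Finset.range n, loss (y i) := by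
  have h0 := h 0
  simp only [sub_zero] at h0
  have h1 : ∑ i ∈ Finset.range n, loss d ≤
      ∑ i ∈ Finset.range n, (Real.log 2 + loss (y i - d) + loss (y i)) :=
    Finset.sum_le_sum fun i _ => loss_le_add (y i) d
  simp only [Finset.sum_add_distrib, Finset.sum_const, Finset.card_range, nsmul_eq_mul] at h1
  linarith

lemma one_add_sq_le (h : IsLossMinimizer y n d) (hn : 0 < n) :
    1 + d ^ 2 ≤ 2 * Real.exp (2 / n * ∑ i ∈ Finset.range n, loss (y i)) := by
  have hn' : (0 : ℝ) < n := by exact_mod_cast hn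
  have h1 : loss d ≤ Real.log 2 + 2 / n * ∑ i ∈ Finset.range n, loss (y i) := by
    have := h.nat_mul_loss_le
    refine le_of_mul_le_mul_left (this.trans_eq ?_) hn'
    field_simp
  calc 1 + d ^ 2 = Real.exp (loss d) := (Real.exp_log (one_add_sq_pos d)).symm
    _ ≤ _ := Real.exp_le_exp.2 h1
    _ = _ := by rw [Real.exp_add, Real.exp_log two_pos]

lemma sum_score_eq_zero (h : IsLossMinimizer y n d) :
    ∑ i ∈ Finset.range n, score (y i - d) = 0 := by
  have hd : HasDerivAt (fun t => ∑ i ∈ Finset.range n, loss (y i - t))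
      (∑ i ∈ Finset.range n, score (y i - d) * (-1)) d := by
    refine HasDerivAt.fun_sum fun i _ => ?_
    have h1 : HasDerivAt (fun t => y i - t) (-1) d := by
      simpa using (hasDerivAt_id d).const_sub (y i)
    exact (hasDerivAt_loss (y i - d)).comp d h1
  have hm : IsLocalMin (fun t => ∑ i ∈ Finset.range n, loss (y i - t)) d :=
    Filter.Eventually.of_forall h
  have := hm.hasDerivAt_eq_zero hd
  rw [← Finset.sum_mul] at this
  linarith

/-- The first-order condition removes the sum of `score (y i - d)`, so only the Taylor remainders
are left. -/
lemma abs_sum_score_sub_le (h : IsLossMinimizer y n d) :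
    |∑ i ∈ Finset.range n, score (y i) - d * ∑ i ∈ Finset.range n, scoreDeriv (y i)|
      ≤ n * (3 * d ^ 2) := by
  have h1 : ∑ i ∈ Finset.range n, score (y i) - d * ∑ i ∈ Finset.range n, scoreDeriv (y i) =
      -∑ i ∈ Finset.range n, (score (y i - d) - score (y i) + d * scoreDeriv (y i)) := by
    rw [Finset.sum_add_distrib, Finset.sum_sub_distrib, h.sum_score_eq_zero, Finset.mul_sum]
    ring
  rw [h1, abs_neg]
  refine (Finset.abs_sum_le_sum_abs _ _).trans ?_
  refine (Finset.sum_le_sum fun i _ => abs_score_sub_taylor_le (y i) d).trans_eq ?_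
  simp

/-- Close to the true value, the average score is nearly `A` times the minimizer. -/
lemma abs_avg_score_sub_le (h : IsLossMinimizer y n d) (hn : 0 < n) {A ε : ℝ} (hd : |d| ≤ ε)
    (hA : |∑ i ∈ Finset.range n, scoreDeriv (y i) - n * A| ≤ n * ε) :
    |(∑ i ∈ Finset.range n, score (y i)) / n - A * d| ≤ 4 * ε * |d| := by
  have hn' : (0 : ℝ) < n := by exact_mod_cast hn
  set S := ∑ i ∈ Finset.range n, score (y i)
  set T := ∑ i ∈ Finset.range n, scoreDeriv (y i)
  have h1 : |S - d * T| ≤ n * (3 * d ^ 2) := h.abs_sum_score_sub_le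
  -- Of the factor `4 * ε`, three parts come from the Taylor remainder through `d² ≤ ε |d|` and one
  -- from replacing the average of `scoreDeriv` by `A`.
  have e : S / n - A * d = ((S - d * T) + d * (T - n * A)) / n := by field_simp; ring
  rw [e, abs_div, abs_of_pos hn', div_le_iff₀ hn']
  refine (abs_add_le _ _).trans ?_
  rw [abs_mul]
  have h2 : |d| * |T - n * A| ≤ |d| * (n * ε) := by gcongr
  have h3 : (n : ℝ) * (3 * d ^ 2) ≤ n * (3 * (ε * |d|)) := by
    rw [← sq_abs d, sq]; gcongr
  linarith

end IsLossMinimizer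

/-! ### Events of probability `o(n⁻³)` -/

section Negligible

variable {Ω : Type*} [MeasurableSpace Ω] {P : Measure Ω}

/-- The probability of the event `S n` is `o(n⁻³)`. -/
def Negligible (P : Measure Ω) (S : ℕ → Set Ω) : Prop :=
  Tendsto (fun n : ℕ => (n : ℝ) ^ 3 * P.real (S n)) atTop (𝓝 0)

lemma Negligible.mono [IsFiniteMeasure P] {S T : ℕ → Set Ω} (hT : Negligible P T)
    (h : ∀ᶠ n in atTop, S n ⊆ T n) : Negligible P S := by
  refine squeeze_zero' (Eventually.of_forall fun n => by positivity) ?_ hT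
  filter_upwards [h] with n hn
  gcongr
  exact measure_ne_top _ _

lemma Negligible.union [IsFiniteMeasure P] {S T : ℕ → Set Ω} (hS : Negligible P S)
    (hT : Negligible P T) : Negligible P fun n => S n ∪ T n := by
  have h : Tendsto (fun n : ℕ => (n : ℝ) ^ 3 * P.real (S n) + (n : ℝ) ^ 3 * P.real (T n))
      atTop (𝓝 0) := by simpa using hS.add hT
  refine squeeze_zero' (Eventually.of_forall fun n => by positivity) ?_ h
  filter_upwards with n
  rw [← mul_add]
  gcongr
  exact measureReal_union_le _ _

lemma negligible_empty : Negligible P fun _ => ∅ := by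
  simp [Negligible]

lemma negligible_of_le_pow {S : ℕ → Set Ω} {r : ℝ} (h0 : 0 ≤ r) (h1 : r < 1)
    (h : ∀ n, P.real (S n) ≤ r ^ n) : Negligible P S := by
  refine squeeze_zero' (Eventually.of_forall fun n => by positivity) ?_
    (tendsto_pow_const_mul_const_pow_of_abs_lt_one 3 (by rwa [abs_of_nonneg h0]))
  filter_upwards with n
  gcongr
  exact h n

end Negligible

/-! ### Deviations and second moments of averages of bounded functions -/

section Sample

variable {Ω : Type*} [MeasurableSpace Ω] {P : Measure Ω} {μ : Measure ℝ} {Y : ℕ → Ω → ℝ}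

lemma integral_comp_law (hlaw : ∀ i, HasLaw (Y i) μ P) {g : ℝ → ℝ} (hg : Measurable g) (i : ℕ) :
    ∫ ω, g (Y i ω) ∂P = ∫ x, g x ∂μ :=
  (hlaw i).integral_comp hg.aestronglyMeasurable

variable [IsProbabilityMeasure P]

/-- Sums of bounded functions of the sample have exponentially small upper deviations. -/
lemma negligible_sum_ge (hind : iIndepFun Y P) (hlaw : ∀ i, HasLaw (Y i) μ P) {g : ℝ → ℝ}
    (hg : Measurable g) {b : ℝ} (hb0 : 0 < b) (hb : ∀ x, |g x| ≤ b) {ε : ℝ} (hε : 0 < ε) :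
    Negligible P fun n =>
      {ω | n * ε ≤ ∑ i ∈ Finset.range n, g (Y i ω) - n * ∫ x, g x ∂μ} := by
  set a := ∫ x, g x ∂μ with ha
  -- Hoeffding's lemma: a variable with values in `[-b, b]` is sub-Gaussian after centring, with the
  -- squared half-length as parameter.
  set c : NNReal := (‖b - (-b)‖₊ / 2) ^ 2 with hc
  have hcpos : (0 : ℝ) < c := by
    rw [hc]
    push_cast
    have : (0 : ℝ) < ‖b - -b‖ := by rw [norm_pos_iff]; linarith
    positivity
  have hsub : ∀ i, HasSubgaussianMGF (fun ω => g (Y i ω) - a) c P := by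
    intro i
    have := hasSubgaussianMGF_of_mem_Icc (μ := P) (X := fun ω => g (Y i ω)) (a := -b) (b := b)
      (hg.comp_aemeasurable (hlaw i).aemeasurable)
      (Eventually.of_forall fun ω => abs_le.1 (hb _))
    rwa [integral_comp_law hlaw hg i] at this
  have hind' : iIndepFun (fun i ω => g (Y i ω) - a) P :=
    hind.comp (fun _ x => g x - a) fun _ => hg.sub_const a
  refine negligible_of_le_pow (r := Real.exp (-(ε ^ 2 / (2 * c)))) (Real.exp_pos _).le
    (by rw [Real.exp_lt_one_iff]; exact neg_neg_of_pos (by positivity)) fun n => ?_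
  have h := HasSubgaussianMGF.measure_sum_range_ge_le_of_iIndepFun hind' (n := n) (c := c)
    (fun i _ => hsub i) (ε := n * ε) (by positivity)
  rw [← Real.exp_nat_mul]
  have e : -(n * ε) ^ 2 / (2 * n * c) = n * -(ε ^ 2 / (2 * c)) := by
    rcases eq_or_ne (n : ℝ) 0 with h0 | h0
    · simp [h0]
    · field_simp
  rw [e] at h
  refine le_trans (le_of_eq ?_) h
  simp [Finset.sum_sub_distrib]

lemma negligible_abs_sum_sub_gt (hind : iIndepFun Y P) (hlaw : ∀ i, HasLaw (Y i) μ P)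
    {g : ℝ → ℝ} (hg : Measurable g) {b : ℝ} (hb0 : 0 < b) (hb : ∀ x, |g x| ≤ b) {ε : ℝ}
    (hε : 0 < ε) : Negligible P fun n =>
      {ω | n * ε < |∑ i ∈ Finset.range n, g (Y i ω) - n * ∫ x, g x ∂μ|} := by
  refine ((negligible_sum_ge hind hlaw hg hb0 hb hε).union
    (negligible_sum_ge hind hlaw hg.neg hb0 (fun x => by simpa using hb x) hε)).mono ?_
  filter_upwards with n ω hω
  rw [Set.mem_ofPred_eq, lt_abs] at hω
  rcases hω with h | h
  · exact Or.inl h.le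
  · refine Or.inr ?_
    simp only [Set.mem_ofPred_eq, Pi.neg_apply, Finset.sum_neg_distrib, integral_neg]
    linarith

/-- The second moment of the average of a bounded centred function of the sample. -/
lemma integral_sq_avg (hind : iIndepFun Y P) (hlaw : ∀ i, HasLaw (Y i) μ P) {g : ℝ → ℝ}
    (hg : Measurable g) {b : ℝ} (hb : ∀ x, |g x| ≤ b) (h0 : ∫ x, g x ∂μ = 0) {n : ℕ}
    (hn : 0 < n) :
    ∫ ω, ((∑ i ∈ Finset.range n, g (Y i ω)) / n) ^ 2 ∂P = (∫ x, g x ^ 2 ∂μ) / n := by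
  have hae : ∀ i, AEMeasurable (fun ω => g (Y i ω)) P := fun i =>
    hg.comp_aemeasurable (hlaw i).aemeasurable
  have hLp : ∀ i, MemLp (fun ω => g (Y i ω)) 2 P := fun i =>
    MemLp.of_bound (hae i).aestronglyMeasurable b (Eventually.of_forall fun ω => hb _)
  have hint : ∀ i, Integrable (fun ω => g (Y i ω)) P := fun i => (hLp i).integrable (by norm_num)
  have hpair : Set.Pairwise (↑(Finset.range n) : Set ℕ)
      fun i j => IndepFun (fun ω => g (Y i ω)) (fun ω => g (Y j ω)) P := fun i _ j _ hij =>
    (hind.comp (fun _ => g) fun _ => hg).indepFun hij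
  have hvar := IndepFun.variance_sum (s := Finset.range n) (fun i _ => hLp i) hpair
  have hz : ∀ i, ∫ ω, g (Y i ω) ∂P = 0 := fun i => by rw [integral_comp_law hlaw hg, h0]
  have hsum : (∑ i ∈ Finset.range n, fun ω => g (Y i ω)) =
      fun ω => ∑ i ∈ Finset.range n, g (Y i ω) := by ext ω; simp
  rw [hsum, variance_of_integral_eq_zero (Finset.aemeasurable_fun_sum _ fun i _ => hae i)
    (by rw [integral_finsetSum _ fun i _ => hint i]; simp [hz])] at hvar
  have hone : ∀ i, variance (fun ω => g (Y i ω)) P = ∫ x, g x ^ 2 ∂μ := fun i => by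
    rw [variance_of_integral_eq_zero (hae i) (hz i)]
    exact integral_comp_law hlaw (hg.pow_const 2) i
  simp only [hone, Finset.sum_const, Finset.card_range, nsmul_eq_mul] at hvar
  simp only [div_pow]
  rw [integral_div, hvar]
  have hn' : (n : ℝ) ≠ 0 := by positivity
  field_simp

end Sample

/-! ### Exponential moments of the loss -/

section Exponential

variable {Ω : Type*} [MeasurableSpace Ω] {P : Measure Ω} {μ : Measure ℝ} {Y : ℕ → Ω → ℝ}

lemma integrable_exp_mul_loss_of_le (hlaw : ∀ i, HasLaw (Y i) μ P) {q s : ℝ} (hsq : s ≤ q)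
    (hq : Integrable (fun x => Real.exp (q * loss x)) μ) (i : ℕ) :
    Integrable (fun ω => Real.exp (s * loss (Y i ω))) P := by
  have h1 : Integrable (fun x => Real.exp (s * loss x)) μ := by
    refine hq.mono' (by fun_prop) (Eventually.of_forall fun x => ?_)
    rw [Real.norm_of_nonneg (Real.exp_pos _).le]
    exact Real.exp_le_exp.2 (mul_le_mul_of_nonneg_right hsq (loss_nonneg x))
  rw [← (hlaw i).map_eq] at h1
  exact h1.comp_aemeasurable (hlaw i).aemeasurable

lemma integral_exp_mul_sum_loss (hind : iIndepFun Y P) (hlaw : ∀ i, HasLaw (Y i) μ P) (s : ℝ)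
    (n : ℕ) : ∫ ω, Real.exp (s * ∑ i ∈ Finset.range n, loss (Y i ω)) ∂P =
      (∫ x, Real.exp (s * loss x) ∂μ) ^ n := by
  have hind' : iIndepFun (fun i ω => loss (Y i ω)) P :=
    hind.comp (fun _ => loss) fun _ => continuous_loss.measurable
  have h := hind'.mgf_sum₀ (t := s)
    (fun i => continuous_loss.measurable.comp_aemeasurable (hlaw i).aemeasurable) (Finset.range n)
  simp only [mgf, Finset.sum_apply] at h
  rw [h]
  have : ∀ i, ∫ ω, Real.exp (s * loss (Y i ω)) ∂P = ∫ x, Real.exp (s * loss x) ∂μ := fun i =>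
    integral_comp_law hlaw (g := fun x => Real.exp (s * loss x))
      (by fun_prop : Continuous fun x => Real.exp (s * loss x)).measurable i
  simp [this]

variable [IsProbabilityMeasure μ]

lemma integrable_exp_mul_sum_loss (hind : iIndepFun Y P) (hlaw : ∀ i, HasLaw (Y i) μ P) {q s : ℝ}
    (hsq : s ≤ q) (hq : Integrable (fun x => Real.exp (q * loss x)) μ) (n : ℕ) :
    Integrable (fun ω => Real.exp (s * ∑ i ∈ Finset.range n, loss (Y i ω))) P := by
  -- The integral of a non-integrable function is `0` by convention, so the positive value given by
  -- the product formula proves integrability.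
  refine Integrable.of_integral_ne_zero ?_
  rw [integral_exp_mul_sum_loss hind hlaw]
  refine pow_ne_zero _ (ne_of_gt ?_)
  have h := integrable_exp_mul_loss_of_le (P := μ) (Y := fun _ => id) (fun _ => HasLaw.id) hsq hq 0
  exact integral_exp_pos h

/-- The moment generating function of the loss is at most exponential near the origin. -/
lemma integral_exp_mul_loss_le {q x : ℝ} (h0 : 0 ≤ x) (h1 : x ≤ 1)
    (hq : Integrable (fun u => Real.exp (q * loss u)) μ) :
    ∫ u, Real.exp (x * q * loss u) ∂μ ≤
      Real.exp (x * (∫ u, Real.exp (q * loss u) ∂μ)) := by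
  set M := ∫ u, Real.exp (q * loss u) ∂μ
  -- Convexity: the exponential lies below its chord between `0` and `q * loss u`.
  have hpt : ∀ u, Real.exp (x * q * loss u) ≤ (1 - x) + x * Real.exp (q * loss u) := fun u => by
    have := convexOn_exp.2 (Set.mem_univ 0) (Set.mem_univ (q * loss u)) (sub_nonneg.2 h1) h0
      (by ring)
    simp only [smul_eq_mul, mul_zero, zero_add, Real.exp_zero, mul_one] at this
    rwa [mul_assoc]
  calc ∫ u, Real.exp (x * q * loss u) ∂μ ≤ ∫ u, ((1 - x) + x * Real.exp (q * loss u)) ∂μ := by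
        refine integral_mono_of_nonneg (Eventually.of_forall fun u => (Real.exp_pos _).le) ?_
          (Eventually.of_forall hpt)
        exact (integrable_const _).add (hq.const_mul x)
    _ = (1 - x) + x * M := by
        rw [integral_add (integrable_const _) (hq.const_mul x), integral_const_mul]; simp [M]
    _ ≤ x * M + 1 := by linarith
    _ ≤ _ := Real.add_one_le_exp _

end Exponential

/-! ### Moments, consistency and mean squared error of the minimizer -/

section LossMinimizer

variable {Ω : Type*} [MeasurableSpace Ω] {P : Measure Ω}
  {μ : Measure ℝ} {Y : ℕ → Ω → ℝ} {D : ℕ → Ω → ℝ}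

/-- Squaring `one_add_sq_le` bounds `D⁴` by four times an exponential whose expectation is the
`n`-th power of the moment generating function of the loss at `4 / n`. Once `4 / n ≤ q`, each factor
is at most `exp (4 M / (n q))`, so the power stays bounded. -/
lemma exists_integral_pow_four_le [IsProbabilityMeasure μ] (hind : iIndepFun Y P)
    (hlaw : ∀ i, HasLaw (Y i) μ P)
    {q : ℝ} (hq0 : 0 < q) (hq : Integrable (fun u => Real.exp (q * loss u)) μ)
    (hD : ∀ n, 0 < n → AEMeasurable (D n) P)
    (hmin : ∀ n, 0 < n → ∀ ω, IsLossMinimizer (fun i => Y i ω) n (D n ω)) :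
    ∃ K : ℝ, ∀ᶠ n : ℕ in atTop,
      Integrable (fun ω => D n ω ^ 4) P ∧ ∫ ω, D n ω ^ 4 ∂P ≤ K := by
  set M := ∫ u, Real.exp (q * loss u) ∂μ
  refine ⟨4 * Real.exp (4 / q * M), ?_⟩
  filter_upwards [eventually_gt_atTop 0, eventually_ge_atTop ⌈4 / q⌉₊] with n hn hnq
  have hn' : (0 : ℝ) < n := by exact_mod_cast hn
  have hnq' : 4 / n ≤ q := by
    rw [div_le_comm₀ hn' hq0]; exact Nat.ceil_le.1 hnq
  have hpt : ∀ ω, D n ω ^ 4 ≤ 4 * Real.exp (4 / n * ∑ i ∈ Finset.range n, loss (Y i ω)) :=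
    fun ω => by
    have h := (hmin n hn ω).one_add_sq_le hn
    have h2 : (1 + D n ω ^ 2) ^ 2 ≤
        (2 * Real.exp (2 / n * ∑ i ∈ Finset.range n, loss (Y i ω))) ^ 2 := by gcongr
    rw [mul_pow, ← Real.exp_nat_mul, ← mul_assoc] at h2
    have e : ((2 : ℕ) : ℝ) * (2 / n) = 4 / n := by push_cast; ring
    rw [e] at h2
    nlinarith [sq_nonneg (D n ω)]
  have hint := (integrable_exp_mul_sum_loss hind hlaw hnq' hq n).const_mul 4
  have hD4 : Integrable (fun ω => D n ω ^ 4) P := by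
    refine hint.mono' ((hD n hn).pow_const 4).aestronglyMeasurable
      (Eventually.of_forall fun ω => ?_)
    rw [Real.norm_of_nonneg (by positivity)]
    exact hpt ω
  refine ⟨hD4, (integral_mono hD4 hint hpt).trans ?_⟩
  rw [integral_const_mul, integral_exp_mul_sum_loss hind hlaw]
  have hx := integral_exp_mul_loss_le (x := 4 / n / q) (by positivity)
    ((div_le_one hq0).2 hnq') hq
  rw [div_mul_cancel₀ _ hq0.ne'] at hx
  gcongr
  refine (pow_le_pow_left₀ (integral_nonneg fun u => (Real.exp_pos _).le) hx n).trans_eq ?_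
  rw [← Real.exp_nat_mul]
  congr 1
  field_simp
  simp [M]

variable [IsProbabilityMeasure P]

/-- Let `h` be the mean excess loss at `t`. If `D n` is within `h / 2` of `t`, the 1-Lipschitz loss
and minimality against `0` force the empirical excess at `t` to be at most `h / 2` per observation.
This is a deviation of `h / 2` for a function bounded by `|t|`. -/
lemma exists_mem_nhds_negligible (hind : iIndepFun Y P) (hlaw : ∀ i, HasLaw (Y i) μ P)
    (hmin : ∀ n, 0 < n → ∀ ω, IsLossMinimizer (fun i => Y i ω) n (D n ω)) {t : ℝ} (ht : t ≠ 0)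
    (hpos : 0 < ∫ x, (loss (x - t) - loss x) ∂μ) :
    ∃ V ∈ 𝓝 t, Negligible P fun n => {ω | D n ω ∈ V} := by
  set h := ∫ x, (loss (x - t) - loss x) ∂μ
  refine ⟨Metric.ball t (h / 2), Metric.ball_mem_nhds t (by positivity), ?_⟩
  have hneg := negligible_sum_ge hind hlaw (g := fun x => -(loss (x - t) - loss x))
    (by fun_prop : Continuous fun x => -(loss (x - t) - loss x)).measurable (abs_pos.2 ht)
    (fun x => by simpa using abs_loss_sub_le x (x - t)) (half_pos hpos)
  refine hneg.mono ?_
  filter_upwards [eventually_gt_atTop 0] with n hn ω hω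
  rw [Set.mem_ofPred_eq, Metric.mem_ball, Real.dist_eq] at hω
  rw [Set.mem_ofPred_eq, integral_neg, Finset.sum_neg_distrib, Finset.sum_sub_distrib]
  have h0 := hmin n hn ω 0
  simp only [sub_zero] at h0
  have h1 : ∑ i ∈ Finset.range n, loss (Y i ω - t) ≤
      ∑ i ∈ Finset.range n, (loss (Y i ω - D n ω) + h / 2) := by
    refine Finset.sum_le_sum fun i _ => ?_
    have h2 := (abs_le.1 (abs_loss_sub_le (Y i ω - t) (Y i ω - D n ω))).2
    have e : Y i ω - t - (Y i ω - D n ω) = D n ω - t := by ring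
    rw [e] at h2
    linarith
  rw [Finset.sum_add_distrib, Finset.sum_const, Finset.card_range, nsmul_eq_mul] at h1
  change _ ≤ _ - n * -h
  linarith

variable [IsProbabilityMeasure μ]

lemma exists_negligible_abs_gt (hind : iIndepFun Y P) (hlaw : ∀ i, HasLaw (Y i) μ P)
    {q : ℝ} (hq0 : 0 < q) (hq : Integrable (fun u => Real.exp (q * loss u)) μ)
    (hmin : ∀ n, 0 < n → ∀ ω, IsLossMinimizer (fun i => Y i ω) n (D n ω)) :
    ∃ R : ℝ, Negligible P fun n => {ω | R < |D n ω|} := by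
  set M := ∫ u, Real.exp (q * loss u) ∂μ
  have hM : 0 < M := integral_exp_pos hq
  -- `L` makes the Chernoff bound `exp (-q n L / 2) * M ^ n` equal to `exp (-n)`.
  set L := 2 / q * (Real.log M + 1) with hL
  have hneg : Negligible P fun n => {ω | n * (L / 2) ≤ ∑ i ∈ Finset.range n, loss (Y i ω)} := by
    refine negligible_of_le_pow (r := Real.exp (-1)) (Real.exp_pos _).le
      (by rw [Real.exp_lt_one_iff]; norm_num) fun n => ?_
    refine (measure_ge_le_exp_mul_mgf _ hq0.le
      (integrable_exp_mul_sum_loss hind hlaw le_rfl hq n)).trans_eq ?_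
    rw [mgf, integral_exp_mul_sum_loss hind hlaw]
    change _ * M ^ n = _
    rw [← Real.exp_log hM, ← Real.exp_nat_mul, ← Real.exp_nat_mul, ← Real.exp_add, hL]
    congr 1
    field_simp
    ring
  -- By `one_add_sq_le`, an error beyond this radius forces the average loss above `L / 2`.
  refine ⟨Real.sqrt (2 * Real.exp L), hneg.mono ?_⟩
  filter_upwards [eventually_gt_atTop 0] with n hn ω hω
  have hn' : (0 : ℝ) < n := by exact_mod_cast hn
  rw [Set.mem_ofPred_eq, Real.sqrt_lt' ((Real.sqrt_nonneg _).trans_lt hω), sq_abs] at hω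
  have h1 : Real.exp L < Real.exp (2 / n * ∑ i ∈ Finset.range n, loss (Y i ω)) := by
    have := (hmin n hn ω).one_add_sq_le hn
    linarith
  rw [Real.exp_lt_exp] at h1
  rw [Set.mem_ofPred_eq]
  have h2 : n * L ≤ n * (2 / n * ∑ i ∈ Finset.range n, loss (Y i ω)) := by gcongr
  have e : n * (2 / n * ∑ i ∈ Finset.range n, loss (Y i ω)) =
      2 * ∑ i ∈ Finset.range n, loss (Y i ω) := by field_simp
  linarith

/-- The loss minimizer is consistent, with superpolynomially small error probabilities. -/
lemma negligible_abs_gt (hind : iIndepFun Y P) (hlaw : ∀ i, HasLaw (Y i) μ P)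
    {q : ℝ} (hq0 : 0 < q) (hq : Integrable (fun u => Real.exp (q * loss u)) μ)
    (hmin : ∀ n, 0 < n → ∀ ω, IsLossMinimizer (fun i => Y i ω) n (D n ω))
    (hpos : ∀ t : ℝ, t ≠ 0 → 0 < ∫ x, (loss (x - t) - loss x) ∂μ) {ε : ℝ} (hε : 0 < ε) :
    Negligible P fun n => {ω | ε < |D n ω|} := by
  obtain ⟨R, hR⟩ := exists_negligible_abs_gt hind hlaw hq0 hq hmin
  have hK : IsCompact (Set.Icc (-R) R ∩ {t : ℝ | ε ≤ |t|}) :=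
    isCompact_Icc.inter_right (isClosed_le continuous_const continuous_abs)
  have hneg : Negligible P fun n => {ω | D n ω ∈ Set.Icc (-R) R ∩ {t : ℝ | ε ≤ |t|}} := by
    -- Negligibility passes to subsets and finite unions, so on a compact set it is enough to have
    -- it near each point.
    refine hK.induction_on (p := fun S => Negligible P fun n => {ω | D n ω ∈ S}) ?_ ?_ ?_ ?_
    · simpa using negligible_empty
    · intro S T hST hT
      exact hT.mono (Eventually.of_forall fun n ω hω => hST hω)
    · intro S T hS hT
      exact hS.union hT
    · intro t ht
      have ht0 : t ≠ 0 := by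
        rintro rfl
        have := ht.2
        simp only [Set.mem_ofPred_eq, abs_zero] at this
        linarith
      obtain ⟨V, hV, hVn⟩ := exists_mem_nhds_negligible hind hlaw hmin ht0 (hpos t ht0)
      exact ⟨V, mem_nhdsWithin_of_mem_nhds hV, hVn⟩
  refine (hneg.union hR).mono (Eventually.of_forall fun n ω hω => ?_)
  rcases le_or_gt |D n ω| R with h | h
  · exact Or.inl ⟨abs_le.1 h, (show ε < |D n ω| from hω).le⟩
  · exact Or.inr h

/-- Upper and lower bounds for the scaled mean squared error of the loss minimizer, up to a
relative error in the expected derivative of the score. -/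
lemma eventually_mse_bounds (hind : iIndepFun Y P) (hlaw : ∀ i, HasLaw (Y i) μ P)
    {q : ℝ} (hq0 : 0 < q) (hq : Integrable (fun u => Real.exp (q * loss u)) μ)
    (hD : ∀ n, 0 < n → AEMeasurable (D n) P)
    (hmin : ∀ n, 0 < n → ∀ ω, IsLossMinimizer (fun i => Y i ω) n (D n ω))
    (hpos : ∀ t : ℝ, t ≠ 0 → 0 < ∫ x, (loss (x - t) - loss x) ∂μ)
    (hscore : ∫ x, score x ∂μ = 0) {A ε : ℝ} (hA : ∫ x, scoreDeriv x ∂μ = A)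
    (hε : 0 < ε) (hεA : 4 * ε < A) :
    ∃ e : ℕ → ℝ, Tendsto e atTop (𝓝 0) ∧ ∀ᶠ n : ℕ in atTop,
      Integrable (fun ω => D n ω ^ 2) P ∧
      n * ∫ ω, D n ω ^ 2 ∂P ≤ (∫ x, score x ^ 2 ∂μ) / (A - 4 * ε) ^ 2 + e n ∧
      ∫ x, score x ^ 2 ∂μ ≤ (A + 4 * ε) ^ 2 * (n * ∫ ω, D n ω ^ 2 ∂P) + e n := by
  obtain ⟨K, hK⟩ := exists_integral_pow_four_le hind hlaw hq0 hq hD hmin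
  have hbad := (negligible_abs_gt hind hlaw hq0 hq hmin hpos hε).union
    (negligible_abs_sum_sub_gt hind hlaw continuous_scoreDeriv.measurable two_pos
      abs_scoreDeriv_le hε)
  set S : ℕ → Set Ω := fun n => {ω | ε < |D n ω|} ∪
    {ω | n * ε < |∑ i ∈ Finset.range n, scoreDeriv (Y i ω) - n * ∫ x, scoreDeriv x ∂μ|}
  -- `D n` and `Y i` are only a.e. measurable, so the bad event is replaced by a measurable hull of
  -- equal probability.
  set T : ℕ → Set Ω := fun n => toMeasurable P (S n)
  have hTm : ∀ n, MeasurableSet (T n) := fun n => measurableSet_toMeasurable P (S n)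
  have hT : ∀ n, P.real (T n) = P.real (S n) := fun n => by
    simp only [T, measureReal_def, measure_toMeasurable]
  set B := ∫ x, score x ^ 2 ∂μ
  set avg : ℕ → Ω → ℝ := fun n ω => (∑ i ∈ Finset.range n, score (Y i ω)) / n
  -- After multiplication by `n`, these two terms are the expectations of `D⁴ / n²` and of `n²`
  -- times the indicator of the bad event.
  refine ⟨fun n => K / n + (n : ℝ) ^ 3 * P.real (S n), ?_, ?_⟩
  · simpa using (tendsto_const_div_atTop_nhds_zero_nat K).add hbad
  filter_upwards [hK, eventually_gt_atTop 0] with n ⟨hint4, hle4⟩ hn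
  have hn' : (0 : ℝ) < n := by exact_mod_cast hn
  have hn1 : (1 : ℝ) ≤ n := by exact_mod_cast hn
  have hgood : ∀ ω, ω ∉ T n → |avg n ω - A * D n ω| ≤ 4 * ε * |D n ω| := fun ω hω => by
    have hS : ω ∉ S n := fun h => hω (subset_toMeasurable P (S n) h)
    simp only [S, Set.mem_union, Set.mem_ofPred_eq, not_or, not_lt, hA] at hS
    exact (hmin n hn ω).abs_avg_score_sub_le hn hS.1 hS.2
  have havg1 : ∀ ω, |avg n ω| ≤ 1 := fun ω => by
    simp only [avg]
    rw [abs_div, abs_of_pos hn', div_le_one hn']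
    refine (Finset.abs_sum_le_sum_abs _ _).trans
      ((Finset.sum_le_sum fun i _ => abs_score_le (Y i ω)).trans_eq ?_)
    simp
  have havgm : AEMeasurable (avg n) P := by
    refine AEMeasurable.div_const (Finset.aemeasurable_fun_sum _ fun i _ => ?_) _
    exact continuous_score.measurable.comp_aemeasurable (hlaw i).aemeasurable
  have havg_int : Integrable (fun ω => avg n ω ^ 2) P :=
    Integrable.of_bound (havgm.pow_const 2).aestronglyMeasurable 1
      (Eventually.of_forall fun ω => by
        rw [Real.norm_of_nonneg (sq_nonneg _)]
        exact (sq_le_one_iff_abs_le_one _).2 (havg1 ω))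
  have havg : ∫ ω, avg n ω ^ 2 ∂P = B / n :=
    integral_sq_avg hind hlaw continuous_score.measurable abs_score_le hscore hn
  have hind_int : ∀ c : ℝ, Integrable ((T n).indicator fun _ => c) P := fun c =>
    (integrable_const c).indicator (hTm n)
  have hD2 : Integrable (fun ω => D n ω ^ 2) P := by
    refine ((integrable_const 1).add hint4).mono' ((hD n hn).pow_const 2).aestronglyMeasurable
      (Eventually.of_forall fun ω => ?_)
    rw [Real.norm_of_nonneg (sq_nonneg _)]
    simp only [Pi.add_apply]
    nlinarith [sq_nonneg (D n ω ^ 2 - 1), sq_nonneg (D n ω)]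
  refine ⟨hD2, ?_, ?_⟩
  · have hpt : ∀ ω, D n ω ^ 2 ≤ avg n ω ^ 2 / (A - 4 * ε) ^ 2 + D n ω ^ 4 / (n : ℝ) ^ 2 +
        (T n).indicator (fun _ => (n : ℝ) ^ 2) ω := fun ω => by
      by_cases hω : ω ∈ T n
      · rw [Set.indicator_of_mem hω]
        have h1 : D n ω ^ 2 ≤ D n ω ^ 4 / (n : ℝ) ^ 2 + (n : ℝ) ^ 2 := by
          have e : D n ω ^ 4 / (n : ℝ) ^ 2 = (D n ω ^ 2 / n) ^ 2 := by ring
          have e2 : D n ω ^ 2 = (D n ω ^ 2 / n) * n := by field_simp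
          rw [e, e2]
          have : D n ω ^ 2 / n * n / n = D n ω ^ 2 / n := by field_simp
          rw [this]
          nlinarith [sq_nonneg (D n ω ^ 2 / n - n), sq_nonneg (D n ω ^ 2 / n), sq_nonneg (n : ℝ)]
        have h2 : 0 ≤ avg n ω ^ 2 / (A - 4 * ε) ^ 2 := by positivity
        linarith
      · rw [Set.indicator_of_notMem hω, add_zero]
        have h1 : (A - 4 * ε) * |D n ω| ≤ |avg n ω| := by
          have h2 := abs_sub_abs_le_abs_sub (A * D n ω) (avg n ω)
          rw [abs_sub_comm, abs_mul, abs_of_pos (by linarith : 0 < A)] at h2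
          linarith [hgood ω hω]
        have h2 : (A - 4 * ε) ^ 2 * D n ω ^ 2 ≤ avg n ω ^ 2 := by
          have := pow_le_pow_left₀ (mul_nonneg (by linarith) (abs_nonneg _)) h1 2
          rwa [mul_pow, sq_abs, sq_abs] at this
        have h3 : D n ω ^ 2 ≤ avg n ω ^ 2 / (A - 4 * ε) ^ 2 := by
          rw [le_div_iff₀ (pow_pos (by linarith) 2)]
          linarith
        have h4 : 0 ≤ D n ω ^ 4 / (n : ℝ) ^ 2 := by positivity
        linarith
    have hsum : Integrable
        (fun ω => avg n ω ^ 2 / (A - 4 * ε) ^ 2 + D n ω ^ 4 / (n : ℝ) ^ 2) P :=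
      (havg_int.div_const _).add (hint4.div_const _)
    have hI := integral_mono hD2 (hsum.add (hind_int _)) hpt
    simp only [Pi.add_apply] at hI
    rw [integral_add hsum (hind_int _),
      integral_add (havg_int.div_const _) (hint4.div_const _), integral_div, integral_div,
      integral_indicator_const _ (hTm n), hT, havg, smul_eq_mul] at hI
    have hI2 := mul_le_mul_of_nonneg_left hI hn'.le
    refine hI2.trans ?_
    have e : n * (B / n / (A - 4 * ε) ^ 2 + (∫ ω, D n ω ^ 4 ∂P) / (n : ℝ) ^ 2 +
        P.real (S n) * (n : ℝ) ^ 2) =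
        B / (A - 4 * ε) ^ 2 + ((∫ ω, D n ω ^ 4 ∂P) / n + (n : ℝ) ^ 3 * P.real (S n)) := by
      field_simp
      ring
    rw [e]
    gcongr
  -- For the lower bound the average score is at most `1` in absolute value, so the bad event costs
  -- only its probability.
  · have hpt : ∀ ω, avg n ω ^ 2 ≤ (A + 4 * ε) ^ 2 * D n ω ^ 2 +
        (T n).indicator (fun _ => (1 : ℝ)) ω := fun ω => by
      by_cases hω : ω ∈ T n
      · rw [Set.indicator_of_mem hω]
        have h1 := (sq_le_one_iff_abs_le_one _).2 (havg1 ω)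
        have h2 : 0 ≤ (A + 4 * ε) ^ 2 * D n ω ^ 2 := by positivity
        linarith
      · rw [Set.indicator_of_notMem hω, add_zero]
        have h1 : |avg n ω| ≤ (A + 4 * ε) * |D n ω| := by
          have h2 := abs_sub_abs_le_abs_sub (avg n ω) (A * D n ω)
          rw [abs_mul, abs_of_pos (by linarith : 0 < A)] at h2
          linarith [hgood ω hω]
        have := pow_le_pow_left₀ (abs_nonneg _) h1 2
        rwa [mul_pow, sq_abs, sq_abs] at this
    have hI := integral_mono havg_int ((hD2.const_mul _).add (hind_int 1)) hpt
    simp only [Pi.add_apply] at hI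
    rw [integral_add (hD2.const_mul _) (hind_int _), integral_const_mul,
      integral_indicator_const _ (hTm n), hT, havg, smul_eq_mul, mul_one, div_le_iff₀ hn'] at hI
    have hK0 : 0 ≤ K / n := by
      have : 0 ≤ K := (integral_nonneg fun ω => by positivity).trans hle4
      positivity
    have h3 : n * P.real (S n) ≤ (n : ℝ) ^ 3 * P.real (S n) := by
      gcongr
      exact le_self_pow₀ hn1 (by norm_num)
    have e : ((A + 4 * ε) ^ 2 * ∫ ω, D n ω ^ 2 ∂P + P.real (S n)) * n =
      (A + 4 * ε) ^ 2 * (n * ∫ ω, D n ω ^ 2 ∂P) + n * P.real (S n) := by ring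
    linarith

/-- The mean squared error of the loss minimizer is asymptotically `B / (A² n)`, with `A` the
expected derivative and `B` the second moment of the score. -/
theorem tendsto_mse (hind : iIndepFun Y P) (hlaw : ∀ i, HasLaw (Y i) μ P)
    {q : ℝ} (hq0 : 0 < q) (hq : Integrable (fun u => Real.exp (q * loss u)) μ)
    (hD : ∀ n, 0 < n → AEMeasurable (D n) P)
    (hmin : ∀ n, 0 < n → ∀ ω, IsLossMinimizer (fun i => Y i ω) n (D n ω))
    (hpos : ∀ t : ℝ, t ≠ 0 → 0 < ∫ x, (loss (x - t) - loss x) ∂μ)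
    (hscore : ∫ x, score x ∂μ = 0) {A B : ℝ} (hA : ∫ x, scoreDeriv x ∂μ = A) (hA0 : 0 < A)
    (hB : ∫ x, score x ^ 2 ∂μ = B) :
    (∀ᶠ n : ℕ in atTop, Integrable (fun ω => D n ω ^ 2) P) ∧
      Tendsto (fun n : ℕ => (n : ℝ) * ∫ ω, D n ω ^ 2 ∂P) atTop (𝓝 (B / A ^ 2)) := by
  have key := fun ε hε hεA => eventually_mse_bounds (A := A) (ε := ε) hind hlaw hq0 hq hD hmin
    hpos hscore hA hε hεA
  rw [hB] at key
  have hsmall : ∀ᶠ ε in 𝓝[>] (0 : ℝ), 0 < ε ∧ 4 * ε < A := by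
    refine eventually_mem_nhdsWithin.and (mem_nhdsWithin_of_mem_nhds ?_)
    exact (by fun_prop : Continuous fun ε : ℝ => 4 * ε).continuousAt.eventually_lt_const
      (by simpa using hA0)
  constructor
  · obtain ⟨ε, hε, hεA⟩ := hsmall.exists
    obtain ⟨e, -, h⟩ := key ε hε hεA
    exact h.mono fun n hn => hn.1
  -- For each strict bound `a`, `ε` is fixed first so that the constant at `ε` is still on the right
  -- side of `a`; then `n` tends to infinity.
  rw [tendsto_order]
  constructor
  · intro a ha
    have hc : Tendsto (fun ε : ℝ => B / (A + 4 * ε) ^ 2) (𝓝[>] 0) (𝓝 (B / A ^ 2)) := by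
      have : ContinuousAt (fun ε : ℝ => B / (A + 4 * ε) ^ 2) 0 :=
        ContinuousAt.div (by fun_prop) (by fun_prop) (by simpa using hA0.ne')
      simpa using this.tendsto.mono_left nhdsWithin_le_nhds
    obtain ⟨ε, ⟨hε, hεA⟩, hlt⟩ := (hsmall.and (hc.eventually_const_lt ha)).exists
    obtain ⟨e, he, h⟩ := key ε hε hεA
    have hpos2 : 0 < (A + 4 * ε) ^ 2 := by positivity
    have h2 : Tendsto (fun n => (B - e n) / (A + 4 * ε) ^ 2) atTop
        (𝓝 (B / (A + 4 * ε) ^ 2)) := by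
      simpa using (he.const_sub B).div_const ((A + 4 * ε) ^ 2)
    filter_upwards [h, h2.eventually_const_lt hlt] with n hn hn2
    refine hn2.trans_le ?_
    rw [div_le_iff₀ hpos2]
    linarith [hn.2.2]
  · intro a ha
    have hc : Tendsto (fun ε : ℝ => B / (A - 4 * ε) ^ 2) (𝓝[>] 0) (𝓝 (B / A ^ 2)) := by
      have : ContinuousAt (fun ε : ℝ => B / (A - 4 * ε) ^ 2) 0 :=
        ContinuousAt.div (by fun_prop) (by fun_prop) (by simpa using hA0.ne')
      simpa using this.tendsto.mono_left nhdsWithin_le_nhds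
    obtain ⟨ε, ⟨hε, hεA⟩, hlt⟩ := (hsmall.and (hc.eventually_lt_const ha)).exists
    obtain ⟨e, he, h⟩ := key ε hε hεA
    have h2 : Tendsto (fun n => B / (A - 4 * ε) ^ 2 + e n) atTop
        (𝓝 (B / (A - 4 * ε) ^ 2)) := by simpa using he.const_add (B / (A - 4 * ε) ^ 2)
    filter_upwards [h, h2.eventually_lt_const hlt] with n hn hn2
    exact hn.2.1.trans_lt hn2

end LossMinimizer

/-! ### The recursion for `∫ (1 + x²)^(-s) dx` -/

section Integrals

/-- The integral `∫ (1 + x²)^(-s) dx`. -/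
def kernelIntegral (s : ℝ) : ℝ := ∫ x : ℝ, (1 + x ^ 2) ^ (-s)

lemma integrable_kernel {s : ℝ} (hs : 1 / 2 < s) :
    Integrable fun x : ℝ => (1 + x ^ 2) ^ (-s) := by
  have h := integrable_rpow_neg_one_add_norm_sq (E := ℝ) (μ := volume) (r := 2 * s)
    (by rw [Module.finrank_self]; push_cast; linarith)
  have e : -(2 * s) / 2 = -s := by ring
  simpa [e] using h

lemma kernel_pos (s x : ℝ) : 0 < (1 + x ^ 2) ^ (-s) := Real.rpow_pos_of_pos (one_add_sq_pos x) _

lemma kernel_eq_exp (s x : ℝ) : (1 + x ^ 2) ^ (-s) = Real.exp (-s * loss x) :=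
  (exp_mul_loss _ _).symm

@[fun_prop]
lemma continuous_kernel (s : ℝ) : Continuous fun x : ℝ => (1 + x ^ 2) ^ (-s) := by
  simp only [kernel_eq_exp]
  fun_prop

lemma kernelIntegral_pos {s : ℝ} (hs : 1 / 2 < s) : 0 < kernelIntegral s := by
  have h := integrable_kernel hs
  simp only [kernel_eq_exp] at h
  simpa only [kernelIntegral, kernel_eq_exp] using integral_exp_pos h

lemma kernel_add_one (s x : ℝ) : (1 + x ^ 2) ^ (-s) = (1 + x ^ 2) ^ (-(s + 1)) * (1 + x ^ 2) := by
  rw [← Real.rpow_add_one (one_add_sq_pos x).ne']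
  congr 1
  ring

/-- The function is dominated by `|x| ^ (1 - 2 s)`. The general filter covers both ends of the line,
where these are the boundary terms of the recursion. -/
lemma tendsto_mul_kernel {s : ℝ} (hs : 1 / 2 < s) {l : Filter ℝ}
    (hl : Tendsto (fun x : ℝ => |x|) l atTop) :
    Tendsto (fun x : ℝ => x * (1 + x ^ 2) ^ (-s)) l (𝓝 0) := by
  have h1 : Tendsto (fun x : ℝ => |x| ^ (-(2 * s - 1))) l (𝓝 0) :=
    (tendsto_rpow_neg_atTop (by linarith)).comp hl
  refine squeeze_zero_norm' ?_ h1
  filter_upwards [hl.eventually_gt_atTop 0] with x hx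
  rw [norm_mul, Real.norm_eq_abs, Real.norm_of_nonneg (kernel_pos s x).le]
  have h2 : (1 + x ^ 2) ^ (-s) ≤ (|x| ^ 2) ^ (-s) := by
    refine Real.rpow_le_rpow_of_nonpos (by positivity) ?_ (by linarith)
    rw [sq_abs]; linarith
  have h3 : |x| * (|x| ^ 2) ^ (-s) = |x| ^ (-(2 * s - 1)) := by
    rw [← Real.rpow_natCast, ← Real.rpow_mul hx.le]
    nth_rewrite 1 [← Real.rpow_one |x|]
    rw [← Real.rpow_add hx]
    congr 1
    push_cast
    ring
  rw [← h3]
  gcongr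

/-- The derivative of `x (1 + x²)^(-s)` is a combination of the two kernels, and its integral
vanishes because the boundary terms do. -/
lemma kernelIntegral_add_one {s : ℝ} (hs : 1 / 2 < s) :
    2 * s * kernelIntegral (s + 1) = (2 * s - 1) * kernelIntegral s := by
  have hderiv : ∀ x : ℝ, HasDerivAt (fun x : ℝ => x * (1 + x ^ 2) ^ (-s))
      ((1 - 2 * s) * (1 + x ^ 2) ^ (-s) + 2 * s * (1 + x ^ 2) ^ (-(s + 1))) x := fun x => by
    have h : HasDerivAt (fun u : ℝ => 1 + u ^ 2) (2 * x) x := by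
      simpa using (hasDerivAt_pow 2 x).const_add 1
    have h2 := (hasDerivAt_id x).mul (h.rpow_const (p := -s) (Or.inl (one_add_sq_pos x).ne'))
    refine h2.congr_deriv ?_
    have e : -s - 1 = -(s + 1) := by ring
    simp only [id, e]
    rw [kernel_add_one s x]
    ring
  have hi := (integrable_kernel hs).const_mul (1 - 2 * s)
  have hi' := (integrable_kernel (by linarith : 1 / 2 < s + 1)).const_mul (2 * s)
  have h := integral_of_hasDerivAt_of_tendsto hderiv (hi.add hi')
    (tendsto_mul_kernel hs tendsto_abs_atBot_atTop) (tendsto_mul_kernel hs tendsto_abs_atTop_atTop)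
  rw [integral_add hi hi', integral_const_mul, integral_const_mul] at h
  change (1 - 2 * s) * kernelIntegral s + 2 * s * kernelIntegral (s + 1) = _ at h
  linarith

end Integrals

/-! ### The Pearson VII law: moments of the score, divergence, information -/

section Law

variable {m : ℝ}

lemma normConst_pos (hm : 1 / 2 < m) : 0 < normConst m := inv_pos.2 (kernelIntegral_pos hm)

lemma density_one (m μ x : ℝ) : density m μ 1 x = normConst m * (1 + (x - μ) ^ 2) ^ (-m) := by
  simp [density]

lemma density_nonneg (hm : 1 / 2 < m) (μ x : ℝ) : 0 ≤ density m μ 1 x := by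
  rw [density_one]
  exact mul_nonneg (normConst_pos hm).le (kernel_pos m _).le

lemma measurable_density (m μ : ℝ) : Measurable (density m μ 1) := by
  have : Continuous (density m μ 1) := by
    have h : density m μ 1 = fun x => normConst m * (1 + (x - μ) ^ 2) ^ (-m) :=
      funext (density_one m μ)
    rw [h]
    exact continuous_const.mul ((continuous_kernel m).comp (continuous_sub_right μ))
  exact this.measurable

lemma integral_law (hm : 1 / 2 < m) (g : ℝ → ℝ) :
    ∫ x, g x ∂law m 0 1 = normConst m * ∫ x, (1 + x ^ 2) ^ (-m) * g x := by
  rw [law, integral_withDensity_eq_integral_toReal_smul (measurable_density m 0).ennreal_ofReal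
    (Eventually.of_forall fun x => ENNReal.ofReal_lt_top), ← integral_const_mul]
  refine integral_congr_ae (Eventually.of_forall fun x => ?_)
  simp only [ENNReal.toReal_ofReal (density_nonneg hm 0 x)]
  simp only [density_one, sub_zero, smul_eq_mul, mul_assoc]

lemma integrable_law (hm : 1 / 2 < m) {g : ℝ → ℝ}
    (hg : Integrable fun x => (1 + x ^ 2) ^ (-m) * g x) : Integrable g (law m 0 1) := by
  rw [law, integrable_withDensity_iff_integrable_smul' (measurable_density m 0).ennreal_ofReal
    (Eventually.of_forall fun x => ENNReal.ofReal_lt_top)]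
  refine (hg.const_mul (normConst m)).congr (Eventually.of_forall fun x => ?_)
  simp only [ENNReal.toReal_ofReal (density_nonneg hm 0 x)]
  simp only [density_one, sub_zero, smul_eq_mul, mul_assoc]

lemma isProbabilityMeasure_law (hm : 1 / 2 < m) : IsProbabilityMeasure (law m 0 1) := by
  constructor
  have hint : Integrable (density m 0 1) := by
    refine ((integrable_kernel hm).const_mul (normConst m)).congr
      (Eventually.of_forall fun x => ?_)
    simp [density_one]
  rw [law, withDensity_apply _ MeasurableSet.univ, setLIntegral_univ,
    ← ofReal_integral_eq_lintegral_ofReal hint (Eventually.of_forall (density_nonneg hm 0))]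
  simp only [density_one, sub_zero]
  rw [integral_const_mul]
  change ENNReal.ofReal ((kernelIntegral m)⁻¹ * kernelIntegral m) = 1
  rw [inv_mul_cancel₀ (kernelIntegral_pos hm).ne', ENNReal.ofReal_one]

lemma hasLaw_sub_const {Ω : Type*} [MeasurableSpace Ω] {P : Measure Ω} {X : Ω → ℝ} {θ : ℝ}
    (hX : HasLaw X (law m θ 1) P) : HasLaw (fun ω => X ω - θ) (law m 0 1) P := by
  have h : MeasurePreserving (fun x : ℝ => x - θ) (law m θ 1) (law m 0 1) := by
    have hmeas : Measurable fun x : ℝ => x - θ := measurable_id.sub_const θ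
    refine ⟨hmeas, ?_⟩
    ext s hs
    have hs' : MeasurableSet ((fun x : ℝ => x - θ) ⁻¹' s) := hmeas hs
    rw [Measure.map_apply hmeas hs, law, law, withDensity_apply _ hs,
      withDensity_apply _ hs',
      ← (measurePreserving_sub_right volume θ).setLIntegral_comp_preimage hs
        (measurable_density m 0).ennreal_ofReal]
    simp only [density_one, sub_zero]
  exact h.fun_comp_hasLaw hX

lemma integral_score_law (hm : 1 / 2 < m) : ∫ x, score x ∂law m 0 1 = 0 := by
  rw [integral_law hm]
  have h := integral_neg_eq_self (fun x : ℝ => (1 + x ^ 2) ^ (-m) * score x) volume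
  have e : (fun x : ℝ => (1 + (-x) ^ 2) ^ (-m) * score (-x)) =
      fun x => -((1 + x ^ 2) ^ (-m) * score x) := by
    funext x
    simp only [score, neg_sq]
    ring
  rw [e, integral_neg] at h
  have : ∫ x : ℝ, (1 + x ^ 2) ^ (-m) * score x = 0 := by linarith
  rw [this, mul_zero]

lemma kernelIntegral_add_one_eq (hm : 1 / 2 < m) :
    kernelIntegral (m + 1) = (2 * m - 1) / (2 * m) * kernelIntegral m := by
  have h := kernelIntegral_add_one hm
  have h0 : m ≠ 0 := by linarith
  field_simp
  linarith

lemma kernelIntegral_add_two_eq (hm : 1 / 2 < m) :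
    kernelIntegral (m + 2) =
      (2 * m + 1) / (2 * (m + 1)) * ((2 * m - 1) / (2 * m) * kernelIntegral m) := by
  rw [← kernelIntegral_add_one_eq hm, show m + 2 = m + 1 + 1 by ring,
    kernelIntegral_add_one_eq (by linarith)]
  ring

lemma integral_scoreDeriv_law (hm : 1 / 2 < m) :
    ∫ x, scoreDeriv x ∂law m 0 1 = (2 * m - 1) / (m + 1) := by
  have h1 := (integrable_kernel (by linarith : 1 / 2 < m + 1)).const_mul 2
  have h2 := (integrable_kernel (by linarith : 1 / 2 < m + 2)).const_mul 4
  -- Writing `1 - x² = 2 - (1 + x²)` turns the integrand into kernels.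
  have e : (fun x : ℝ => (1 + x ^ 2) ^ (-m) * scoreDeriv x) =
      fun x => 4 * (1 + x ^ 2) ^ (-(m + 2)) - 2 * (1 + x ^ 2) ^ (-(m + 1)) := by
    funext x
    have := one_add_sq_pos x
    rw [kernel_add_one m, kernel_add_one (m + 1), show m + 1 + 1 = m + 2 by ring, scoreDeriv]
    field_simp
    ring
  rw [integral_law hm, e, integral_sub h2 h1, integral_const_mul, integral_const_mul]
  change normConst m * (4 * kernelIntegral (m + 2) - 2 * kernelIntegral (m + 1)) = _
  rw [kernelIntegral_add_one_eq hm, kernelIntegral_add_two_eq hm]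
  change (kernelIntegral m)⁻¹ * _ = _
  have hK := (kernelIntegral_pos hm).ne'
  have h0 : m ≠ 0 := by linarith
  have h3 : m + 1 ≠ 0 := by linarith
  field_simp
  ring

lemma integral_score_sq_law (hm : 1 / 2 < m) :
    ∫ x, score x ^ 2 ∂law m 0 1 = (2 * m - 1) / (m * (m + 1)) := by
  have h1 := (integrable_kernel (by linarith : 1 / 2 < m + 1)).const_mul 4
  have h2 := (integrable_kernel (by linarith : 1 / 2 < m + 2)).const_mul 4
  -- Here `x² = (1 + x²) - 1` is used.
  have e : (fun x : ℝ => (1 + x ^ 2) ^ (-m) * score x ^ 2) =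
      fun x => 4 * (1 + x ^ 2) ^ (-(m + 1)) - 4 * (1 + x ^ 2) ^ (-(m + 2)) := by
    funext x
    have := one_add_sq_pos x
    rw [kernel_add_one m, kernel_add_one (m + 1), show m + 1 + 1 = m + 2 by ring, score]
    field_simp
    ring
  rw [integral_law hm, e, integral_sub h1 h2, integral_const_mul, integral_const_mul]
  change normConst m * (4 * kernelIntegral (m + 1) - 4 * kernelIntegral (m + 2)) = _
  rw [kernelIntegral_add_one_eq hm, kernelIntegral_add_two_eq hm]
  change (kernelIntegral m)⁻¹ * _ = _
  have hK := (kernelIntegral_pos hm).ne'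
  have h0 : m ≠ 0 := by linarith
  have h3 : m + 1 ≠ 0 := by linarith
  field_simp
  ring

lemma exists_integrable_exp_mul_loss_law (hm : 1 / 2 < m) :
    ∃ q > 0, Integrable (fun x => Real.exp (q * loss x)) (law m 0 1) := by
  -- With this `q`, the exponent `m - q` is the midpoint of `1 / 2` and `m`, so the kernel remains
  -- integrable.
  refine ⟨(m - 1 / 2) / 2, by linarith, integrable_law hm ?_⟩
  refine (integrable_kernel (s := m - (m - 1 / 2) / 2) (by linarith)).congr
    (Eventually.of_forall fun x => ?_)
  simp only [kernel_eq_exp, ← Real.exp_add]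
  congr 1
  ring

lemma eq_half_of_loss_sub_eq {t x : ℝ} (ht : t ≠ 0) (h : loss (x - t) = loss x) : x = t / 2 := by
  have h1 := Real.log_injOn_pos (one_add_sq_pos (x - t)) (one_add_sq_pos x) h
  have h2 : t * (t - 2 * x) = 0 := by linarith
  rcases mul_eq_zero.1 h2 with h3 | h3
  · exact absurd h3 ht
  · linarith

/-- The Kullback-Leibler divergence between distinct translates is positive. -/
lemma integral_loss_sub_pos (hm : 1 / 2 < m) {t : ℝ} (ht : t ≠ 0) :
    0 < ∫ x, (loss (x - t) - loss x) ∂law m 0 1 := by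
  have := isProbabilityMeasure_law hm
  have hm0 : 0 < m := by linarith
  -- `r` is the likelihood ratio of the translate by `t`, with integral `1`, and `g = r - 1 - log r`
  -- is nonnegative. It vanishes only where `r = 1`, that is at most at `t / 2`, a null set; its
  -- integral is `m` times the claimed quantity.
  set r : ℝ → ℝ := fun x => Real.exp (-m * (loss (x - t) - loss x)) with hr
  set g : ℝ → ℝ := fun x => r x + (m * (loss (x - t) - loss x) - 1) with hg
  have hdiff : Integrable (fun x => loss (x - t) - loss x) (law m 0 1) :=
    Integrable.of_bound
      (by fun_prop : Continuous fun x => loss (x - t) - loss x).aestronglyMeasurable |t|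
      (Eventually.of_forall fun x => by simpa using abs_loss_sub_le (x - t) x)
  have hkr : (fun x : ℝ => (1 + x ^ 2) ^ (-m) * r x) = fun x => (1 + (x - t) ^ 2) ^ (-m) := by
    funext x
    rw [hr, kernel_eq_exp, kernel_eq_exp, ← Real.exp_add]
    congr 1
    ring
  have hrint : Integrable r (law m 0 1) := by
    refine integrable_law hm ?_
    rw [hkr]
    exact (integrable_kernel hm).comp_sub_right t
  have hr1 : ∫ x, r x ∂law m 0 1 = 1 := by
    rw [integral_law hm, hkr, integral_sub_right_eq_self (fun x : ℝ => (1 + x ^ 2) ^ (-m)) t]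
    exact inv_mul_cancel₀ (kernelIntegral_pos hm).ne'
  have hint2 : Integrable (fun x => m * (loss (x - t) - loss x) - 1) (law m 0 1) :=
    (hdiff.const_mul m).sub (integrable_const 1)
  have hgint : ∫ x, g x ∂law m 0 1 = m * ∫ x, (loss (x - t) - loss x) ∂law m 0 1 := by
    rw [hg, integral_add hrint hint2, integral_sub (hdiff.const_mul m) (integrable_const 1), hr1,
      integral_const_mul]
    simp
  have hg0 : 0 ≤ g := fun x => by
    have := Real.add_one_le_exp (-m * (loss (x - t) - loss x))
    simp only [hg, hr, Pi.zero_apply]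
    linarith
  have hsupp : {t / 2}ᶜ ⊆ Function.support g := fun x hx hgx => by
    by_cases h : loss (x - t) = loss x
    · exact hx (eq_half_of_loss_sub_eq ht h)
    · have := Real.add_one_lt_exp (x := -m * (loss (x - t) - loss x))
        (mul_ne_zero (neg_ne_zero.2 hm0.ne') (sub_ne_zero.2 h))
      simp only [hg, hr] at hgx
      linarith
  have hatom : law m 0 1 {t / 2} = 0 :=
    withDensity_absolutelyContinuous volume _ Real.volume_singleton
  have hpos : 0 < ∫ x, g x ∂law m 0 1 := by
    rw [integral_pos_iff_support_of_nonneg hg0 (hrint.add hint2)]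
    refine lt_of_lt_of_le ?_ (measure_mono hsupp)
    rw [prob_compl_eq_one_sub (measurableSet_singleton _), hatom]
    simp
  rw [hgint] at hpos
  exact pos_of_mul_pos_right hpos hm0.le

lemma deriv_log_density (hm : 1 / 2 < m) (x θ : ℝ) :
    deriv (fun t => Real.log (density m t 1 x)) θ = m * score (x - θ) := by
  have e : (fun t => Real.log (density m t 1 x)) =
      fun t => Real.log (normConst m) - m * loss (x - t) := by
    funext t
    rw [density_one, Real.log_mul (normConst_pos hm).ne' (kernel_pos m _).ne', kernel_eq_exp,
      Real.log_exp]
    ring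
  have h1 : HasDerivAt (fun t => x - t) (-1) θ := by
    simpa using (hasDerivAt_id θ).const_sub x
  have h2 := (((hasDerivAt_loss (x - θ)).comp θ h1).const_mul m).const_sub
    (Real.log (normConst m))
  rw [e]
  refine HasDerivAt.deriv (h2.congr_deriv ?_)
  ring

lemma fisherInformation_eq (hm : 1 / 2 < m) (θ : ℝ) :
    fisherInformation m θ = m * (2 * m - 1) / (m + 1) := by
  have hlaw : HasLaw (fun x => x - θ) (law m 0 1) (law m θ 1) := hasLaw_sub_const HasLaw.id
  have h := hlaw.integral_comp (f := fun x => score x ^ 2)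
    (continuous_score.pow 2).aestronglyMeasurable
  simp only [fisherInformation, deriv_log_density hm, mul_pow]
  rw [integral_const_mul]
  refine (congrArg (m ^ 2 * ·) h).trans ?_
  simp only [integral_score_sq_law hm]
  have h0 : m ≠ 0 := by linarith
  have h3 : m + 1 ≠ 0 := by linarith
  field_simp

lemma likelihood_eq (m : ℝ) {n : ℕ} (x : Fin n → ℝ) (t : ℝ) :
    likelihood m x t = normConst m ^ n * Real.exp (-m * ∑ i, loss (x i - t)) := by
  simp only [likelihood, density_one, kernel_eq_exp]
  rw [Finset.prod_mul_distrib, Finset.mul_sum, Real.exp_sum]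
  simp

/-- The error of a maximum likelihood estimate minimizes the empirical loss of the centred
sample. -/
lemma IsMLE.isLossMinimizer (hm : 1 / 2 < m) {n : ℕ} {T : (Fin n → ℝ) → ℝ} (hT : IsMLE m n T)
    (x : ℕ → ℝ) (θ : ℝ) :
    IsLossMinimizer (fun i => x i - θ) n (T (fun i => x i) - θ) := fun t => by
  -- A competitor `t` for the centred sample corresponds to the location `θ + t`.
  have h := hT.maximizes (fun i => x i) (θ + t)
  rw [likelihood_eq, likelihood_eq, mul_le_mul_iff_right₀ (pow_pos (normConst_pos hm) n),
    Real.exp_le_exp] at h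
  have h2 := le_of_mul_le_mul_left (by linarith :
    m * ∑ i : Fin n, loss (x i - T fun i => x i) ≤ m * ∑ i : Fin n, loss (x i - (θ + t)))
    (by linarith : 0 < m)
  simp only [sub_sub, add_sub_cancel]
  rwa [Finset.sum_range, Finset.sum_range]

end Law

end PearsonVII

end

theorem theorem1p6 {Ω : Type*} [MeasurableSpace Ω] (P : Measure Ω) [IsProbabilityMeasure P]
    (m : ℝ) (hm : 1 / 2 < m) (θ : ℝ)
    (X : ℕ → Ω → ℝ) (hindep : iIndepFun X P)
    (hlaw : ∀ i, HasLaw (X i) (PearsonVII.law m θ 1) P)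
    (thetaHat : (n : ℕ) → (Fin n → ℝ) → ℝ)
    (hMLE : ∀ n, 1 ≤ n → PearsonVII.IsMLE m n (thetaHat n)) :
    (∀ᶠ n : ℕ in atTop,
      Integrable (fun ω => (thetaHat n (fun i : Fin n => X i ω) - θ) ^ 2) P) ∧
    Tendsto (fun n : ℕ => (n : ℝ) * ∫ ω, (thetaHat n (fun i : Fin n => X i ω) - θ) ^ 2 ∂P)
      atTop (𝓝 ((m + 1) / (m * (2 * m - 1)))) ∧
    (m + 1) / (m * (2 * m - 1)) = (PearsonVII.fisherInformation m θ)⁻¹ := by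
  have := PearsonVII.isProbabilityMeasure_law hm
  obtain ⟨q, hq0, hq⟩ := PearsonVII.exists_integrable_exp_mul_loss_law hm
  have h0 : m ≠ 0 := by linarith
  have h1 : m + 1 ≠ 0 := by linarith
  have h2 : 2 * m - 1 ≠ 0 := by linarith
  have hlim := PearsonVII.tendsto_mse (Y := fun i ω => X i ω - θ)
    (D := fun n ω => thetaHat n (fun i : Fin n => X i ω) - θ)
    (hindep.comp (fun _ x => x - θ) fun _ => measurable_id.sub_const θ)
    (fun i => PearsonVII.hasLaw_sub_const (hlaw i)) hq0 hq
    (fun n hn => ((hMLE n hn).measurable.comp_aemeasurable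
      (aemeasurable_pi_lambda _ fun i => (hlaw i).aemeasurable)).sub_const θ)
    (fun n hn ω => (hMLE n hn).isLossMinimizer hm (fun i => X i ω) θ)
    (fun t ht => PearsonVII.integral_loss_sub_pos hm ht) (PearsonVII.integral_score_law hm)
    (PearsonVII.integral_scoreDeriv_law hm) (div_pos (by linarith) (by linarith))
    (PearsonVII.integral_score_sq_law hm)
  have e : (2 * m - 1) / (m * (m + 1)) / ((2 * m - 1) / (m + 1)) ^ 2 =
      (m + 1) / (m * (2 * m - 1)) := by field_simp
  rw [e] at hlim
  exact ⟨hlim.1, hlim.2, by rw [PearsonVII.fisherInformation_eq hm, inv_div]⟩
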